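/- Let $\mathbb K\in\{\mathbb R,\mathbb C\}$, let $X$ be a Banach space over $\mathbb K$, and let $X'$ be its topological dual with the dual norm. All operators are bounded and linear, and "weakly" always refers to the weak topology $\sigma(E,E')$ of the Banach space $E$ in question (so to $\sigma(X',X'')$ on $X'$). A norm bounded set $A\subseteq X$ is a *Dunford--Pettis (DP) set* if $\lim_{n\to\infty}\sup_{x\in A}|f_n(x)|=0$ for every weakly null sequence $(f_n)$ in $X'$. A norm bounded set $A\subseteq X'$ is an *L-Dunford--Pettis set* if $\lim_{n\to\infty}\sup_{f\in A}|f(x_n)|=0$ for every weakly null sequence $(x_n)$ in $X$ such that $\{x_n : n\in\mathbb N\}$ is a DP set. An operator $T\colon X\to Y$ into a Banach space $Y$ is *Dunford--Pettis completely continuous (DPcc)* if $\|Tx_n\|\to 0$ for every weakly null sequence $(x_n)$ in $X$ such that $\{x_n : n\in\mathbb N\}$ is a DP set; it is *weakly compact* if it maps the closed unit ball of $X$ onto a relatively weakly compact subset of $Y$. The space $X$ has the *L-Dunford--Pettis property* if every L-Dunford--Pettis set in $X'$ is relatively weakly compact. Then the following are equivalent: 1. $X$ has the L-Dunford--Pettis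 property; 2. for every Banach space $Y$ over $\mathbb K$, every DPcc operator from $X$ into $Y$ is weakly compact; 3. every DPcc operator from $X$ into $\ell^\infty$ is weakly compact, where $\ell^\infty$ is the Banach space of all bounded $\mathbb K$-valued sequences with the supremum norm. -/

import Mathlib

open Filter Topology Set
open scoped ENNReal
universe u v

section LDP

variable (𝕜 : Type) [RCLike 𝕜]

/-- A sequence is weakly null if it converges to `0` in the weak topology `σ(E, E')`. -/
def WeaklyNull {E : Type*} [NormedAddCommGroup E] [NormedSpace 𝕜 E] (x : ℕ → E) : Prop :=
  Tendsto (fun n => toWeakSpace 𝕜 E (x n)) atTop (𝓝 0)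

/-- A subset is relatively weakly compact if its closure in the weak topology `σ(E, E')` is
compact in that topology. -/
def RelativelyWeaklyCompact {E : Type*} [NormedAddCommGroup E] [NormedSpace 𝕜 E]
    (A : Set E) : Prop :=
  IsCompact (closure (toWeakSpace 𝕜 E '' A))

/-- A norm bounded set `A ⊆ X` is a Dunford-Pettis set if every weakly null sequence of the
(normed) dual `X'` converges to zero uniformly on `A`. -/
def IsDPSet {X : Type*} [NormedAddCommGroup X] [NormedSpace 𝕜 X] (A : Set X) : Prop :=
  Bornology.IsBounded A ∧
    ∀ f : ℕ → StrongDual 𝕜 X, WeaklyNull 𝕜 f →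
      TendstoUniformlyOn (fun n x => f n x) (fun _ => (0 : 𝕜)) atTop A

/-- A norm bounded set `A ⊆ X'` is an L-Dunford-Pettis set if every weakly null sequence of `X`
whose range is a Dunford-Pettis set converges to zero uniformly on `A`. -/
def IsLDPSet {X : Type*} [NormedAddCommGroup X] [NormedSpace 𝕜 X]
    (A : Set (StrongDual 𝕜 X)) : Prop :=
  Bornology.IsBounded A ∧
    ∀ x : ℕ → X, WeaklyNull 𝕜 x → IsDPSet 𝕜 (range x) →
      TendstoUniformlyOn (fun n (f : StrongDual 𝕜 X) => f (x n)) (fun _ => (0 : 𝕜)) atTop A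

/-- The L-Dunford-Pettis property: every L-Dunford-Pettis subset of `X'` is relatively weakly
compact, for the weak topology `σ(X', X'')`. -/
def HasLDPProperty (X : Type*) [NormedAddCommGroup X] [NormedSpace 𝕜 X] : Prop :=
  ∀ A : Set (StrongDual 𝕜 X), IsLDPSet 𝕜 A → RelativelyWeaklyCompact 𝕜 A

variable {𝕜}

/-- Dunford-Pettis completely continuous operators: weakly null sequences whose range is a
Dunford-Pettis set are mapped to norm null sequences. -/
def IsDPcc {X Y : Type*} [NormedAddCommGroup X] [NormedSpace 𝕜 X]
    [NormedAddCommGroup Y] [NormedSpace 𝕜 Y] (T : X →L[𝕜] Y) : Prop :=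
  ∀ x : ℕ → X, WeaklyNull 𝕜 x → IsDPSet 𝕜 (range x) →
    Tendsto (fun n => T (x n)) atTop (𝓝 0)

/-- Weakly compact operators: the image of the closed unit ball is relatively weakly compact. -/
def IsWeaklyCompactOperator {X Y : Type*} [NormedAddCommGroup X] [NormedSpace 𝕜 X]
    [NormedAddCommGroup Y] [NormedSpace 𝕜 Y] (T : X →L[𝕜] Y) : Prop :=
  RelativelyWeaklyCompact 𝕜 (T '' Metric.closedBall (0 : X) 1)

end LDP

/-
A norm bounded set `A` of a Banach space `E` is relatively weakly compact iff its weak* closure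
in `E''` stays inside `E`. By Goldstine's theorem, `T : X → Y` is therefore weakly compact iff
`T''` maps `X''` into `Y`, and Gantmacher's theorem follows: `T` is weakly compact iff its adjoint
`T'` (`ContinuousLinearMap.precomp 𝕜 T`) is.

If `T` is DPcc then `T'` maps the unit ball of `Y'` onto an L-Dunford-Pettis set, so the
L-Dunford-Pettis property makes `T'`, hence `T`, weakly compact. Conversely, a bounded sequence
`f` in `X'` is the sequence of coordinates of an operator `T : X → ℓ^∞`, which is DPcc when `f`
ranges in an L-Dunford-Pettis set, and the `f n` are the images under `T'` of the coordinate
functionals, of norm at most one. So weak compactness of `T` gives `f` a weak cluster point, which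
suffices by the Eberlein-Šmulian theorem.
-/

set_option maxSynthPendingDepth 3

section Bidual

variable {𝕜 : Type*} [RCLike 𝕜] {E : Type*} [NormedAddCommGroup E] [NormedSpace 𝕜 E]

theorem opNorm_le_of_forall_re_le {g : StrongDual 𝕜 E} {r : ℝ}
    (hg : ∀ x, ‖x‖ ≤ 1 → RCLike.re (g x) ≤ r) : ‖g‖ ≤ r := by
  refine le_of_forall_lt fun c hc => ?_
  obtain ⟨x, hx, hcx⟩ := g.exists_lt_apply_of_lt_opNorm hc
  obtain ⟨a, ha, hax⟩ := RCLike.exists_norm_eq_mul_self (g x)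
  have hre : RCLike.re (g (a • x)) = ‖g x‖ := by
    rw [map_smul, smul_eq_mul, ← hax, RCLike.ofReal_re]
  exact hcx.trans_le (hre ▸ hg (a • x) (by rw [norm_smul, ha, one_mul]; exact hx.le))

theorem exists_forall_norm_sub_lt_of_mem_closure {S : Set (WeakDual 𝕜 E)} {z : WeakDual 𝕜 E}
    (hz : z ∈ closure S) {t : Set E} (ht : t.Finite) {ε : ℝ} (hε : 0 < ε) :
    ∃ w ∈ S, ∀ x ∈ t, ‖z x - w x‖ < ε := by
  have hnear : ∀ᶠ w in 𝓝 z, ∀ x ∈ t, ‖z x - w x‖ < ε := by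
    refine (eventually_all_finite ht).mpr fun x _ => ?_
    have hcont : Continuous fun w : WeakDual 𝕜 E => ‖z x - w x‖ :=
      (continuous_const.sub (WeakDual.eval_continuous x)).norm
    exact (hcont.tendsto z).eventually_lt_const (by simpa using hε)
  obtain ⟨w, hw, hwS⟩ := mem_closure_iff_nhds.mp hz _ hnear
  exact ⟨w, hwS, hw⟩

theorem convex_inclusionInDoubleDualWeak_image_closedBall (r : ℝ) :
    Convex ℝ (NormedSpace.inclusionInDoubleDualWeak 𝕜 E ''
      (toWeakSpace 𝕜 E '' Metric.closedBall 0 r)) := by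
  let _ := NormedSpace.restrictScalars ℝ 𝕜 E
  rw [image_image]
  refine (convex_closedBall (0 : E) r).is_linear_image ⟨fun x y => ?_, fun c x => ?_⟩
  · rw [map_add, map_add]
  · rw [RCLike.real_smul_eq_coe_smul (K := 𝕜) c, RCLike.real_smul_eq_coe_smul (K := 𝕜) c, map_smul,
      map_smul]

theorem exists_re_apply_lt_of_notMem {K : Set (WeakDual 𝕜 E)} (hconv : Convex ℝ K)
    (hclosed : IsClosed K) {φ : WeakDual 𝕜 E} (hφ : φ ∉ K) :
    ∃ (x : E) (r : ℝ), (∀ ψ ∈ K, RCLike.re (ψ x) < r) ∧ r < RCLike.re (φ x) := by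
  have : LocallyConvexSpace ℝ (WeakDual 𝕜 E) :=
    inferInstanceAs (LocallyConvexSpace ℝ (WeakBilin (topDualPairing 𝕜 E)))
  obtain ⟨l, r, hl, hr⟩ :=
    RCLike.geometric_hahn_banach_closed_point (𝕜 := 𝕜) hconv hclosed hφ
  obtain ⟨x, rfl⟩ := LinearMap.dualEmbedding_surjective (topDualPairing 𝕜 E) l
  exact ⟨x, r, hl, hr⟩

theorem closure_inclusionInDoubleDualWeak_image_closedBall :
    closure (NormedSpace.inclusionInDoubleDualWeak 𝕜 E ''
      (toWeakSpace 𝕜 E '' Metric.closedBall 0 1)) =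
      WeakDual.toStrongDual ⁻¹' Metric.closedBall (0 : StrongDual 𝕜 (StrongDual 𝕜 E)) 1 := by
  refine (closure_minimal ?_ (WeakDual.isClosed_closedBall _ _)).antisymm fun φ hφ => ?_
  · rintro _ ⟨_, ⟨x, hx, rfl⟩, rfl⟩
    exact mem_closedBall_zero_iff.mpr
      ((NormedSpace.double_dual_bound 𝕜 E x).trans (mem_closedBall_zero_iff.mp hx))
  by_contra hφK
  obtain ⟨f, r, hf, hr⟩ := exists_re_apply_lt_of_notMem
    (convex_inclusionInDoubleDualWeak_image_closedBall (𝕜 := 𝕜) (E := E) 1).closure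
    isClosed_closure hφK
  have hfr : ‖f‖ ≤ r := opNorm_le_of_forall_re_le fun x hx =>
    (hf _ (subset_closure ⟨_, ⟨x, mem_closedBall_zero_iff.mpr hx, rfl⟩, rfl⟩)).le
  have hφf : RCLike.re (φ f) ≤ ‖f‖ :=
    (RCLike.re_le_norm _).trans <|
      ((WeakDual.toStrongDual φ).le_of_opNorm_le (mem_closedBall_zero_iff.mp hφ) f).trans_eq
        (one_mul _)
  exact hr.not_ge (hφf.trans hfr)

theorem exists_norm_le_one_forall_norm_sub_lt {φ : StrongDual 𝕜 (StrongDual 𝕜 E)} (hφ : ‖φ‖ ≤ 1)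
    {t : Set (StrongDual 𝕜 E)} (ht : t.Finite) {ε : ℝ} (hε : 0 < ε) :
    ∃ x : E, ‖x‖ ≤ 1 ∧ ∀ f ∈ t, ‖φ f - f x‖ < ε := by
  have hmem : StrongDual.toWeakDual φ ∈ closure (NormedSpace.inclusionInDoubleDualWeak 𝕜 E ''
      (toWeakSpace 𝕜 E '' Metric.closedBall 0 1)) := by
    rw [closure_inclusionInDoubleDualWeak_image_closedBall]
    exact mem_closedBall_zero_iff.mpr hφ
  obtain ⟨_, ⟨_, ⟨x, hx, rfl⟩, rfl⟩, hφx⟩ := exists_forall_norm_sub_lt_of_mem_closure hmem ht hε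
  exact ⟨x, mem_closedBall_zero_iff.mp hx, hφx⟩

theorem exists_strongDual_ne_zero_of_notMem_isClosed {p : Submodule 𝕜 E}
    (hp : IsClosed (p : Set E)) {x : E} (hx : x ∉ p) :
    ∃ f : StrongDual 𝕜 E, ‖f‖ ≤ 1 ∧ f x ≠ 0 ∧ ∀ y ∈ p, f y = 0 := by
  have hpx : ‖p.mkQL x‖ ≠ 0 := by
    rw [Submodule.mkQL_apply, Submodule.mkQ_apply]
    exact fun h => hx (QuotientAddGroup.norm_mk_eq_zero.mp h)
  obtain ⟨g, hg, hgx⟩ := exists_dual_vector 𝕜 (p.mkQL x) hpx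
  refine ⟨g ∘L p.mkQL, ?_, ?_, fun y hy => ?_⟩
  · refine ContinuousLinearMap.opNorm_le_bound _ zero_le_one fun y => ?_
    exact (g.le_of_opNorm_le hg.le _).trans (by gcongr; exact Submodule.Quotient.norm_mk_le p y)
  · rwa [ContinuousLinearMap.comp_apply, hgx, RCLike.ofReal_ne_zero]
  · rw [ContinuousLinearMap.comp_apply, Submodule.mkQL_apply, Submodule.mkQ_apply,
      (Submodule.Quotient.mk_eq_zero p).mpr hy, map_zero]

variable (𝕜 E) in
theorem isClosed_range_inclusionInDoubleDual [CompleteSpace E] :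
    IsClosed ((NormedSpace.inclusionInDoubleDual 𝕜 E).range :
      Set (StrongDual 𝕜 (StrongDual 𝕜 E))) :=
  (NormedSpace.inclusionInDoubleDualLi (E := E) 𝕜).isometry.isUniformInducing.isComplete_range
    |>.isClosed

end Bidual

section Eberlein

variable {𝕜 : Type*} [RCLike 𝕜] {E : Type*} [NormedAddCommGroup E] [NormedSpace 𝕜 E]

theorem norm_sub_apply_le_of_mapClusterPt {x : ℕ → E} {a : E}
    (ha : MapClusterPt (toWeakSpace 𝕜 E a) atTop fun n => toWeakSpace 𝕜 E (x n))
    {f : StrongDual 𝕜 E} {c : 𝕜} {ε : ℝ} (hfx : ∀ᶠ n in atTop, ‖c - f (x n)‖ ≤ ε) :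
    ‖c - f a‖ ≤ ε := by
  have hclosed : IsClosed {y : WeakSpace 𝕜 E | ‖c - f ((toWeakSpace 𝕜 E).symm y)‖ ≤ ε} :=
    isClosed_le (continuous_const.sub
      (WeakBilin.eval_continuous (topDualPairing 𝕜 E).flip f)).norm continuous_const
  exact hclosed.mem_of_mapClusterPt ha hfx

theorem eventually_norm_apply_le_of_mem_weak_closure {x : ℕ → E} {a : E}
    (ha : toWeakSpace 𝕜 E a ∈ closure (toWeakSpace 𝕜 E '' range x))
    {f : ℕ → StrongDual 𝕜 E} (hf : ∀ n, ‖f n‖ ≤ 1) {r η : ℝ}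
    (hfx : ∀ k, ∀ᶠ n in atTop, ‖f n (x k)‖ ≤ r) (hη : 0 < η) :
    ∀ᶠ n in atTop, ‖f n a‖ ≤ r + η := by
  let _ := NormedSpace.restrictScalars ℝ 𝕜 E
  let S : Set E := {y | ∀ᶠ n in atTop, ‖f n y‖ ≤ r}
  have hconv : Convex ℝ S := fun y hy w hw s t hs ht hst => by
    filter_upwards [hy, hw] with n hny hnw
    have hball := (convex_closedBall (0 : 𝕜) r).linear_preimage
      ((f n).toLinearMap.restrictScalars ℝ)
    exact mem_closedBall_zero_iff.mp (hball (mem_closedBall_zero_iff.mpr hny)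
      (mem_closedBall_zero_iff.mpr hnw) hs ht hst)
  have hxS : range x ⊆ S := range_subset_iff.mpr hfx
  have haS : toWeakSpace 𝕜 E a ∈ closure (toWeakSpace 𝕜 E '' S) :=
    closure_mono (image_mono hxS) ha
  rw [← hconv.toWeakSpace_closure 𝕜, (toWeakSpace 𝕜 E).injective.mem_set_image] at haS
  obtain ⟨y, hy, hay⟩ := Metric.mem_closure_iff.mp haS η hη
  filter_upwards [hy] with n hn
  calc ‖f n a‖ = ‖f n y + f n (a - y)‖ := by rw [← map_add, add_sub_cancel]
    _ ≤ ‖f n y‖ + ‖f n (a - y)‖ := norm_add_le _ _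
    _ ≤ r + ‖a - y‖ := add_le_add hn <|
      ((f n).le_of_opNorm_le (hf n) _).trans_eq (one_mul _)
    _ ≤ r + η := by gcongr; exact (dist_eq_norm a y ▸ hay).le

theorem exists_seq_dual_seq_forall_lt_of_mem_closure {A : Set E} {z : WeakDual 𝕜 (StrongDual 𝕜 E)}
    (hz : z ∈ closure (NormedSpace.inclusionInDoubleDualWeak 𝕜 E '' (toWeakSpace 𝕜 E '' A)))
    {ψ : StrongDual 𝕜 (StrongDual 𝕜 (StrongDual 𝕜 E))} (hψ : ‖ψ‖ ≤ 1)
    (hψι : ∀ x, ψ (NormedSpace.inclusionInDoubleDual 𝕜 E x) = 0) {ε : ℝ} (hε : 0 < ε) :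
    ∃ (f : ℕ → StrongDual 𝕜 E) (x : ℕ → E), (∀ n, ‖f n‖ ≤ 1) ∧ (∀ n, x n ∈ A) ∧
      (∀ n, ‖ψ (WeakDual.toStrongDual z) - z (f n)‖ < ε) ∧
      (∀ m n, m < n → ‖f n (x m)‖ < ε) ∧ ∀ m n, m < n → ‖z (f m) - f m (x n)‖ < ε := by
  obtain ⟨p, hp, hpp⟩ := exists_seq_of_forall_finset_exists
    (fun p : StrongDual 𝕜 E × E =>
      ‖p.1‖ ≤ 1 ∧ p.2 ∈ A ∧ ‖ψ (WeakDual.toStrongDual z) - z p.1‖ < ε)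
    (fun p q => ‖q.1 p.2‖ < ε ∧ ‖z p.1 - p.1 q.2‖ < ε) fun s _ => by
      obtain ⟨g, hg, hgψ⟩ := exists_norm_le_one_forall_norm_sub_lt hψ
        (t := insert (WeakDual.toStrongDual z)
          ((fun p : StrongDual 𝕜 E × E => NormedSpace.inclusionInDoubleDual 𝕜 E p.2) '' s))
        ((s.finite_toSet.image _).insert _) hε
      obtain ⟨_, ⟨_, ⟨y, hy, rfl⟩, rfl⟩, hzy⟩ :=
        exists_forall_norm_sub_lt_of_mem_closure hz (s.finite_toSet.image Prod.fst) hε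
      refine ⟨(g, y), ⟨hg, hy, hgψ _ (mem_insert _ _)⟩, fun p hp => ⟨?_, ?_⟩⟩
      · simpa [hψι] using hgψ _ (mem_insert_of_mem _ (mem_image_of_mem _ hp))
      · exact hzy _ (mem_image_of_mem _ hp)
  exact ⟨fun n => (p n).1, fun n => (p n).2, fun n => (hp n).1, fun n => (hp n).2.1,
    fun n => (hp n).2.2, fun m n h => (hpp m n h).1, fun m n h => (hpp m n h).2⟩

end Eberlein

section WeakCompactness

variable {𝕜 : Type} [RCLike 𝕜] {E X Y Z : Type*} [NormedAddCommGroup E] [NormedSpace 𝕜 E]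
  [NormedAddCommGroup X] [NormedSpace 𝕜 X] [NormedAddCommGroup Y] [NormedSpace 𝕜 Y]
  [NormedAddCommGroup Z] [NormedSpace 𝕜 Z]

theorem relativelyWeaklyCompact_iff_closure_subset_range {A : Set E}
    (hA : Bornology.IsBounded A) :
    RelativelyWeaklyCompact 𝕜 A ↔
      closure (NormedSpace.inclusionInDoubleDualWeak 𝕜 E '' (toWeakSpace 𝕜 E '' A)) ⊆
        range (NormedSpace.inclusionInDoubleDualWeak 𝕜 E) := by
  refine ⟨fun h => ?_, NormedSpace.isCompact_closure_of_isBounded 𝕜 E _ ?_⟩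
  · rw [← image_closure_of_isCompact h
      (NormedSpace.inclusionInDoubleDualWeak 𝕜 E).continuous.continuousOn]
    exact image_subset_range _ _
  · rwa [preimage_image_eq _ (toWeakSpace 𝕜 E).injective]

theorem RelativelyWeaklyCompact.mono {A B : Set E} (hB : RelativelyWeaklyCompact 𝕜 B)
    (hAB : A ⊆ B) : RelativelyWeaklyCompact 𝕜 A :=
  hB.of_isClosed_subset isClosed_closure (closure_mono (image_mono hAB))

theorem RelativelyWeaklyCompact.image {A : Set X} (hA : RelativelyWeaklyCompact 𝕜 A)
    (T : X →L[𝕜] Y) : RelativelyWeaklyCompact 𝕜 (T '' A) := by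
  refine (IsCompact.image hA (WeakSpace.map T).continuous).closure_of_subset ?_
  rintro _ ⟨_, ⟨x, hx, rfl⟩, rfl⟩
  exact ⟨_, subset_closure (mem_image_of_mem _ hx), rfl⟩

theorem relativelyWeaklyCompact_of_forall_seq_mapClusterPt [CompleteSpace E] {A : Set E}
    (hA : Bornology.IsBounded A)
    (h : ∀ x : ℕ → E, (∀ n, x n ∈ A) →
      ∃ a : E, MapClusterPt (toWeakSpace 𝕜 E a) atTop fun n => toWeakSpace 𝕜 E (x n)) :
    RelativelyWeaklyCompact 𝕜 A := by
  refine (relativelyWeaklyCompact_iff_closure_subset_range hA).mpr fun z hz => ?_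
  by_contra hzE
  obtain ⟨ψ, hψ, hψz, hψι⟩ := exists_strongDual_ne_zero_of_notMem_isClosed
    (isClosed_range_inclusionInDoubleDual 𝕜 E) (x := WeakDual.toStrongDual z)
    fun ⟨x, hx⟩ => hzE ⟨toWeakSpace 𝕜 E x, congrArg StrongDual.toWeakDual hx⟩
  obtain ⟨ε, hε, hψε⟩ : ∃ ε > 0, ‖ψ (WeakDual.toStrongDual z)‖ = 4 * ε :=
    ⟨‖ψ (WeakDual.toStrongDual z)‖ / 4, by positivity, by ring⟩
  obtain ⟨f, x, hf, hxA, hψf, hfx, hzf⟩ :=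
    exists_seq_dual_seq_forall_lt_of_mem_closure hz hψ (fun x => hψι _ ⟨x, rfl⟩) hε
  -- `f n (x k)` is close to `ψ z` if `k → ∞` first and to `0` if `n → ∞` first; evaluating the
  -- `f n` at a weak cluster point of `x` makes the two iterated limits agree.
  obtain ⟨a, ha⟩ := h x hxA
  have ha_closure : toWeakSpace 𝕜 E a ∈ closure (toWeakSpace 𝕜 E '' range x) :=
    isClosed_closure.mem_of_mapClusterPt ha <|
      .of_forall fun n => subset_closure (mem_image_of_mem _ (mem_range_self n))
  have hfa : ∀ᶠ n in atTop, ‖f n a‖ ≤ ε + ε :=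
    eventually_norm_apply_le_of_mem_weak_closure ha_closure hf
      (fun k => (eventually_gt_atTop k).mono fun n hn => (hfx k n hn).le) hε
  have hzf_a : ∀ n, ‖z (f n) - f n a‖ ≤ ε := fun n =>
    norm_sub_apply_le_of_mapClusterPt ha <|
      (eventually_gt_atTop n).mono fun k hk => (hzf n k hk).le
  obtain ⟨n, hn⟩ := hfa.exists
  have hlt : ‖ψ (WeakDual.toStrongDual z)‖ < 4 * ε := calc
    ‖ψ (WeakDual.toStrongDual z)‖
      = ‖(ψ (WeakDual.toStrongDual z) - z (f n)) + (z (f n) - f n a) + f n a‖ := by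
        rw [sub_add_sub_cancel, sub_add_cancel]
    _ ≤ ‖ψ (WeakDual.toStrongDual z) - z (f n)‖ + ‖z (f n) - f n a‖ + ‖f n a‖ :=
        norm_add₃_le
    _ < 4 * ε := by linarith [hψf n, hzf_a n]
  exact hlt.ne hψε

theorem IsWeaklyCompactOperator.clm_comp {T : X →L[𝕜] Y} (hT : IsWeaklyCompactOperator T)
    (S : Y →L[𝕜] Z) : IsWeaklyCompactOperator (S ∘L T) := by
  have himage := RelativelyWeaklyCompact.image hT S
  rwa [← image_comp] at himage

theorem closure_inclusionInDoubleDualWeak_image_clm_image_closedBall (T : X →L[𝕜] Y) :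
    closure (NormedSpace.inclusionInDoubleDualWeak 𝕜 Y ''
      (toWeakSpace 𝕜 Y '' (T '' Metric.closedBall 0 1))) =
    (fun φ : WeakDual 𝕜 (StrongDual 𝕜 X) =>
      StrongDual.toWeakDual (WeakDual.toStrongDual φ ∘L ContinuousLinearMap.precomp 𝕜 T)) ''
      (WeakDual.toStrongDual ⁻¹' Metric.closedBall 0 1) := by
  have hcont : Continuous fun φ : WeakDual 𝕜 (StrongDual 𝕜 X) =>
      StrongDual.toWeakDual (WeakDual.toStrongDual φ ∘L ContinuousLinearMap.precomp 𝕜 T) :=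
    WeakDual.continuous_of_continuous_eval fun g => WeakDual.eval_continuous (g ∘L T)
  have hcompact := WeakDual.isCompact_closedBall (𝕜 := 𝕜) (0 : StrongDual 𝕜 (StrongDual 𝕜 X)) 1
  rw [← closure_inclusionInDoubleDualWeak_image_closedBall] at hcompact ⊢
  rw [image_closure_of_isCompact hcompact hcont.continuousOn]
  simp only [image_image]
  rfl

theorem isWeaklyCompactOperator_iff_comp_precomp_mem_range {T : X →L[𝕜] Y} :
    IsWeaklyCompactOperator T ↔ ∀ φ : StrongDual 𝕜 (StrongDual 𝕜 X),
      φ ∘L ContinuousLinearMap.precomp 𝕜 T ∈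
        (NormedSpace.inclusionInDoubleDual 𝕜 Y).range := by
  have hbounded := T.lipschitz.isBounded_image (Metric.isBounded_closedBall (x := 0) (r := 1))
  rw [IsWeaklyCompactOperator, relativelyWeaklyCompact_iff_closure_subset_range hbounded,
    closure_inclusionInDoubleDualWeak_image_clm_image_closedBall]
  refine ⟨fun h => ?_, ?_⟩
  · let p := (NormedSpace.inclusionInDoubleDual 𝕜 Y).range.comap
      (ContinuousLinearMap.precomp 𝕜 (ContinuousLinearMap.precomp 𝕜 T)).toLinearMap
    have hball : Metric.closedBall 0 1 ⊆ (p : Set (StrongDual 𝕜 (StrongDual 𝕜 X))) :=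
      fun φ hφ => h (mem_image_of_mem _ hφ)
    have hp : (p : Set (StrongDual 𝕜 (StrongDual 𝕜 X))) ∈ 𝓝 0 :=
      mem_of_superset (Metric.closedBall_mem_nhds 0 one_pos) hball
    have htop : p = ⊤ := p.eq_top_of_nonempty_interior' ⟨0, mem_interior_iff_mem_nhds.mpr hp⟩
    exact Submodule.eq_top_iff'.mp htop
  · rintro h _ ⟨φ, -, rfl⟩
    exact h (WeakDual.toStrongDual φ)

theorem IsWeaklyCompactOperator.precomp {T : X →L[𝕜] Y} (hT : IsWeaklyCompactOperator T) :
    IsWeaklyCompactOperator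
      (ContinuousLinearMap.precomp 𝕜 T : StrongDual 𝕜 Y →L[𝕜] StrongDual 𝕜 X) := by
  rw [isWeaklyCompactOperator_iff_comp_precomp_mem_range] at hT ⊢
  intro ψ
  refine ⟨(ψ ∘L NormedSpace.inclusionInDoubleDual 𝕜 Y) ∘L T, ?_⟩
  ext φ
  obtain ⟨y, hy⟩ := hT φ
  calc φ ((ψ ∘L NormedSpace.inclusionInDoubleDual 𝕜 Y) ∘L T)
      = NormedSpace.inclusionInDoubleDual 𝕜 Y y (ψ ∘L NormedSpace.inclusionInDoubleDual 𝕜 Y) :=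
        (DFunLike.congr_fun hy (ψ ∘L NormedSpace.inclusionInDoubleDual 𝕜 Y)).symm
    _ = ψ (φ ∘L ContinuousLinearMap.precomp 𝕜 T) := congrArg ψ hy

theorem isWeaklyCompactOperator_precomp_iff [CompleteSpace Y] {T : X →L[𝕜] Y} :
    IsWeaklyCompactOperator
      (ContinuousLinearMap.precomp 𝕜 T : StrongDual 𝕜 Y →L[𝕜] StrongDual 𝕜 X) ↔
      IsWeaklyCompactOperator T := by
  refine ⟨fun h => ?_, IsWeaklyCompactOperator.precomp⟩
  rw [isWeaklyCompactOperator_iff_comp_precomp_mem_range] at h ⊢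
  intro φ
  by_contra hφ
  obtain ⟨ψ, -, hψφ, hψ⟩ := exists_strongDual_ne_zero_of_notMem_isClosed
    (isClosed_range_inclusionInDoubleDual 𝕜 Y) hφ
  obtain ⟨f, hf⟩ := h ψ
  have hf_zero : f = 0 := by
    ext x
    exact (DFunLike.congr_fun hf (NormedSpace.inclusionInDoubleDual 𝕜 X x)).trans
      (hψ _ ⟨T x, rfl⟩)
  have hψφ_eq : φ f = ψ (φ ∘L ContinuousLinearMap.precomp 𝕜 T) := DFunLike.congr_fun hf φ
  exact hψφ (by rw [← hψφ_eq, hf_zero, map_zero])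

end WeakCompactness

section DunfordPettis

variable {𝕜 : Type} [RCLike 𝕜] {X : Type*} {Y : Type u} {Z : Type*} [NormedAddCommGroup X]
  [NormedSpace 𝕜 X] [NormedAddCommGroup Y] [NormedSpace 𝕜 Y] [NormedAddCommGroup Z]
  [NormedSpace 𝕜 Z]

theorem IsLDPSet.mono {A B : Set (StrongDual 𝕜 X)} (hB : IsLDPSet 𝕜 B) (hAB : A ⊆ B) :
    IsLDPSet 𝕜 A :=
  ⟨hB.1.subset hAB, fun x hx hDP => (hB.2 x hx hDP).mono hAB⟩

theorem IsDPcc.clm_comp {T : X →L[𝕜] Y} (hT : IsDPcc T) (S : Y →L[𝕜] Z) : IsDPcc (S ∘L T) :=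
  fun x hx hDP => by simpa using! (S.continuous.tendsto 0).comp (hT x hx hDP)

theorem IsDPcc.isLDPSet_precomp_image_closedBall {T : X →L[𝕜] Y} (hT : IsDPcc T) :
    IsLDPSet 𝕜 ((ContinuousLinearMap.precomp 𝕜 T : StrongDual 𝕜 Y →L[𝕜] StrongDual 𝕜 X) ''
      Metric.closedBall 0 1) := by
  let T' : StrongDual 𝕜 Y →L[𝕜] StrongDual 𝕜 X := ContinuousLinearMap.precomp 𝕜 T
  refine ⟨T'.lipschitz.isBounded_image Metric.isBounded_closedBall, fun x hx hDP => ?_⟩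
  rw [Metric.tendstoUniformlyOn_iff]
  intro ε hε
  filter_upwards [Metric.tendsto_nhds.mp (hT x hx hDP) ε hε] with n hn
  rintro _ ⟨g, hg, rfl⟩
  rw [dist_zero_right] at hn
  rw [dist_zero_left]
  calc ‖g (T (x n))‖ ≤ 1 * ‖T (x n)‖ := g.le_of_opNorm_le (mem_closedBall_zero_iff.mp hg) _
    _ < ε := by rwa [one_mul]

theorem isDPcc_of_isLDPSet_range_evalCLM_comp {ι : Type*} {T : X →L[𝕜] lp (fun _ : ι => 𝕜) ∞}
    (hT : IsLDPSet 𝕜 (range fun i => lp.evalCLM 𝕜 (fun _ : ι => 𝕜) ∞ i ∘L T)) : IsDPcc T := by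
  intro x hx hDP
  have hunif := Metric.tendstoUniformlyOn_iff.mp (hT.2 x hx hDP)
  rw [Metric.tendsto_nhds]
  intro ε hε
  filter_upwards [hunif (ε / 2) (half_pos hε)] with n hn
  have hcoord : ∀ i, ‖T (x n) i‖ ≤ ε / 2 := fun i =>
    (dist_zero_left _).symm.trans_le (hn _ (mem_range_self i)).le
  rw [dist_zero_right]
  exact (lp.norm_le_of_forall_le (half_pos hε).le hcoord).trans_lt (half_lt_self hε)

theorem exists_clm_lp_infty_of_isBounded_range {ι : Type*} {f : ι → StrongDual 𝕜 X}
    (hf : Bornology.IsBounded (range f)) :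
    ∃ T : X →L[𝕜] lp (fun _ : ι => 𝕜) ∞, ∀ i, lp.evalCLM 𝕜 (fun _ : ι => 𝕜) ∞ i ∘L T = f i := by
  obtain ⟨M, hM, hfM⟩ := hf.exists_pos_norm_le
  have hbound : ∀ x i, ‖f i x‖ ≤ M * ‖x‖ := fun x i =>
    (f i).le_of_opNorm_le (hfM _ (mem_range_self i)) x
  let L : X →ₗ[𝕜] lp (fun _ : ι => 𝕜) ∞ :=
    { toFun := fun x => ⟨fun i => f i x, memℓp_infty ⟨M * ‖x‖, forall_mem_range.mpr (hbound x)⟩⟩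
      map_add' := fun x y => by ext i; exact map_add (f i) x y
      map_smul' := fun c x => by ext i; exact map_smul (f i) c x }
  exact ⟨L.mkContinuous M fun x =>
    lp.norm_le_of_forall_le (by positivity) (hbound x), fun i => rfl⟩

theorem IsWeaklyCompactOperator.relativelyWeaklyCompact_range_evalCLM_comp {ι : Type*}
    {T : X →L[𝕜] lp (fun _ : ι => 𝕜) ∞} (hT : IsWeaklyCompactOperator T) :
    RelativelyWeaklyCompact 𝕜 (range fun i => lp.evalCLM 𝕜 (fun _ : ι => 𝕜) ∞ i ∘L T) := by
  refine RelativelyWeaklyCompact.mono hT.precomp (range_subset_iff.mpr fun i => ?_)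
  refine mem_image_of_mem (ContinuousLinearMap.precomp 𝕜 T) (mem_closedBall_zero_iff.mpr ?_)
  exact LinearMap.mkContinuous_norm_le _ zero_le_one _

theorem IsLDPSet.relativelyWeaklyCompact_of_lp_infty
    (h : ∀ T : X →L[𝕜] lp (fun _ : ℕ => 𝕜) ∞, IsDPcc T → IsWeaklyCompactOperator T)
    {A : Set (StrongDual 𝕜 X)} (hA : IsLDPSet 𝕜 A) : RelativelyWeaklyCompact 𝕜 A := by
  refine relativelyWeaklyCompact_of_forall_seq_mapClusterPt hA.1 fun f hf => ?_
  have hfLDP : IsLDPSet 𝕜 (range f) := hA.mono (range_subset_iff.mpr hf)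
  obtain ⟨T, hT⟩ := exists_clm_lp_infty_of_isBounded_range hfLDP.1
  obtain rfl : _ = f := funext hT
  have hcompact := (h T (isDPcc_of_isLDPSet_range_evalCLM_comp hfLDP))
    |>.relativelyWeaklyCompact_range_evalCLM_comp
  obtain ⟨a, -, ha⟩ := IsCompact.exists_mapClusterPt hcompact (f := atTop)
    (tendsto_principal.mpr <| .of_forall fun n : ℕ =>
      subset_closure (mem_image_of_mem (toWeakSpace 𝕜 _) (mem_range_self n)))
  exact ⟨(toWeakSpace 𝕜 _).symm a, ha⟩

theorem isWeaklyCompactOperator_of_forall_ulift {T : X →L[𝕜] Y} (hT : IsDPcc T)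
    (h : ∀ S : X →L[𝕜] ULift.{v} Y, IsDPcc S → IsWeaklyCompactOperator S) :
    IsWeaklyCompactOperator T :=
  let e : ULift.{v} Y ≃L[𝕜] Y := ContinuousLinearEquiv.ulift
  (h _ (hT.clm_comp (e.symm : Y →L[𝕜] ULift.{v} Y))).clm_comp (e : ULift.{v} Y →L[𝕜] Y)

end DunfordPettis

theorem mainTheorem1_general (𝕜 : Type) [RCLike 𝕜]
    (X : Type u) [NormedAddCommGroup X] [NormedSpace 𝕜 X] :
    List.TFAE
      [HasLDPProperty 𝕜 X,
       ∀ (Y : Type v) [NormedAddCommGroup Y] [NormedSpace 𝕜 Y] [CompleteSpace Y]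
         (T : X →L[𝕜] Y), IsDPcc T → IsWeaklyCompactOperator T,
       ∀ T : X →L[𝕜] lp (fun _ : ℕ => 𝕜) ∞, IsDPcc T → IsWeaklyCompactOperator T] := by
  tfae_have 1 → 2 := fun h Y _ _ _ T hT =>
    isWeaklyCompactOperator_precomp_iff.mp (h _ hT.isLDPSet_precomp_image_closedBall)
  tfae_have 2 → 3 := fun h T hT =>
    isWeaklyCompactOperator_of_forall_ulift hT fun S hS =>
      h (ULift.{v} (lp (fun _ : ℕ => 𝕜) ∞)) S hS
  tfae_have 3 → 1 := fun h A hA => hA.relativelyWeaklyCompact_of_lp_infty h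
  tfae_finish

theorem mainTheorem1 (𝕜 : Type) [RCLike 𝕜]
    (X : Type u) [NormedAddCommGroup X] [NormedSpace 𝕜 X] [CompleteSpace X] :
    List.TFAE
      [HasLDPProperty 𝕜 X,
       ∀ (Y : Type v) [NormedAddCommGroup Y] [NormedSpace 𝕜 Y] [CompleteSpace Y]
         (T : X →L[𝕜] Y), IsDPcc T → IsWeaklyCompactOperator T,
       ∀ T : X →L[𝕜] lp (fun _ : ℕ => 𝕜) ∞, IsDPcc T → IsWeaklyCompactOperator T] :=
  mainTheorem1_general 𝕜 X
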